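/- Let $(R,\mathfrak m)$ be a commutative local Noetherian ring of Krull dimension $d \ge 2$ whose residue field $R/\mathfrak m$ is finite. A reduction of an ideal $I$ of $R$ is an ideal $J \subseteq I$ such that $I^{r+1} = J I^{r}$ for some integer $r > 0$; it is proper if $J \ne I$. An ideal is minimally generated by $n$ elements if it can be generated by $n$ elements but not by fewer. Then, for every positive integer $n$, there is an ideal of $R$ that is minimally generated by $n$ elements and has no proper reduction. If moreover $n \ge d$, then this ideal can be chosen to be $\mathfrak m$-primary, that is, primary with radical $\mathfrak m$. -/

import Mathlib

/-- `J` is a reduction of `I`: a subideal `J` of `I` with `I ^ (r + 1) = J * I ^ r`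
for some positive integer `r`. -/
def Ideal.IsReductionOf {R : Type*} [CommRing R] (J I : Ideal R) : Prop :=
  J ≤ I ∧ ∃ r : ℕ, 0 < r ∧ I ^ (r + 1) = J * I ^ r

/-- `I` has no proper reduction: its only reduction is `I` itself. -/
def Ideal.HasNoProperReduction {R : Type*} [CommRing R] (I : Ideal R) : Prop :=
  ∀ J : Ideal R, J.IsReductionOf I → J = I

/-- `I` is minimally generated by `n` elements: some `n` elements generate `I`, and no family of
fewer than `n` elements does. -/
def Ideal.IsMinimallyGeneratedBy {R : Type*} [CommRing R] (I : Ideal R) (n : ℕ) : Prop :=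
  (∃ x : Fin n → R, Ideal.span (Set.range x) = I) ∧
    ∀ m : ℕ, m < n → ¬ ∃ x : Fin m → R, Ideal.span (Set.range x) = I

/-! Let k be the residue field and I = (a_1, ..., a_n). Suppose every form relation H(a) = 0 reduces
to a polynomial vanishing on all of k^n (`FormsVanishAtRationalPoints`). By Nakayama, the linear
forms giving elements of a proper reduction J have residues killed by some nonzero l in k^n. So
every element of J I^r is the value at a of a form vanishing at l. Comparing with a_i^(r+1) gives
l_i = 0 for all i, a contradiction. The same condition forces n generators.

Such a are found as a_i = G_i(x), with x a system of parameters and G_i forms of one degree D.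
Analytic independence of x turns relations on a into relations on the reduced G_i over k. These
vanish at every l that G attains at a point over some nonzero k-algebra. As k is finite, there are
finitely many l, while the affine line over k has infinitely many closed points, so the Chinese
remainder theorem yields binary forms attaining every nonzero l. Here d ≥ 2 is used. If the G_i also
have no nontrivial common zero over any extension field, I is primary to the maximal ideal. For n ≤
d, part of x already works. -/

/-! ### Analytic independence of systems of parameters -/

section AnalyticIndependence
open MvPolynomial

/-- The prime ideal of polynomials all of whose coefficients lie in a given prime. -/
noncomputable def PrimeSpectrum.mvPolynomialExtension {R : Type*} [CommRing R] (σ : Type*)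
    (p : PrimeSpectrum R) : PrimeSpectrum (MvPolynomial σ R) :=
  ⟨RingHom.ker (MvPolynomial.map (σ := σ) (Ideal.Quotient.mk p.asIdeal)), RingHom.ker_isPrime _⟩

lemma PrimeSpectrum.mem_mvPolynomialExtension {R σ : Type*} [CommRing R] {p : PrimeSpectrum R}
    {F : MvPolynomial σ R} :
    F ∈ (p.mvPolynomialExtension σ).asIdeal ↔ ∀ s, F.coeff s ∈ p.asIdeal := by
  simp [mvPolynomialExtension, RingHom.mem_ker, MvPolynomial.ext_iff, coeff_map,
    Ideal.Quotient.eq_zero_iff_mem]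

/-- A prime is recovered from its extension as the set of constants in it. Strict chains therefore
extend to strict chains, and heights do not drop. -/
lemma PrimeSpectrum.mvPolynomialExtension_strictMono {R : Type*} [CommRing R] (σ : Type*) :
    StrictMono (PrimeSpectrum.mvPolynomialExtension (R := R) σ) := by
  classical
  refine Monotone.strictMono_of_injective ?_ ?_
  · intro p q h F hF
    rw [mem_mvPolynomialExtension] at hF ⊢
    exact fun s => h (hF s)
  · intro p q h
    have key : ∀ (p : PrimeSpectrum R) (r : R), r ∈ p.asIdeal ↔
        C r ∈ (p.mvPolynomialExtension σ).asIdeal := by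
      intro p r
      rw [mem_mvPolynomialExtension]
      refine ⟨fun hr s => ?_, fun hr => by simpa using hr 0⟩
      rw [coeff_C]
      split_ifs
      exacts [hr, zero_mem _]
    ext r
    rw [key, key, h]

lemma MvPolynomial.IsHomogeneous.eval₂_const_mul {R S σ : Type*} [CommSemiring R] [CommSemiring S]
    {F : MvPolynomial σ R} {N : ℕ} (hF : F.IsHomogeneous N) (f : R →+* S) (c : S) (u : σ → S) :
    MvPolynomial.eval₂ f (fun i => c * u i) F = c ^ N * MvPolynomial.eval₂ f u F := by
  rw [MvPolynomial.eval₂_eq, MvPolynomial.eval₂_eq, Finset.mul_sum]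
  refine Finset.sum_congr rfl fun d hd => ?_
  have hdN : d.degree = N := by
    rw [Finsupp.degree_eq_weight_one]
    exact hF (mem_support_iff.1 hd)
  simp_rw [mul_pow, Finset.prod_mul_distrib]
  rw [Finset.prod_pow_eq_pow_sum, ← Finsupp.degree_apply, hdN]
  ring

lemma MvPolynomial.IsHomogeneous.aeval_const_mul {R S σ : Type*} [CommSemiring R] [CommSemiring S]
    [Algebra R S] {F : MvPolynomial σ R} {N : ℕ} (hF : F.IsHomogeneous N) (c : S) (u : σ → S) :
    MvPolynomial.aeval (fun i => c * u i) F = c ^ N * MvPolynomial.aeval u F :=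
  hF.eval₂_const_mul _ c u

/-- A system of parameters is analytically independent: a form vanishing on it has all its
coefficients in the maximal ideal. -/
lemma MvPolynomial.map_residue_eq_zero_of_eval_eq_zero {R σ : Type*} [CommRing R] [IsLocalRing R]
    [IsNoetherianRing R] [Finite σ] (hdim : ringKrullDim R = Nat.card σ) {x : σ → R}
    (hx : (Ideal.span (Set.range x)).radical = IsLocalRing.maximalIdeal R)
    {F : MvPolynomial σ R} {N : ℕ} (hF : F.IsHomogeneous N) (h0 : eval x F = 0) :
    F.map (IsLocalRing.residue R) = 0 := by
  classical
  have := Fintype.ofFinite σ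
  by_contra hne
  set M : PrimeSpectrum R := IsLocalRing.closedPoint R with hM
  set P := M.mvPolynomialExtension σ with hP
  have hFP : F ∉ P.asIdeal := hne
  rcases isEmpty_or_nonempty σ with hσ | ⟨⟨o⟩⟩
  · apply hne
    obtain ⟨r, rfl⟩ := C_surjective σ F
    simp at h0
    simp [h0]
  have hxm : ∀ i, x i ∈ IsLocalRing.maximalIdeal R := fun i =>
    hx ▸ Ideal.le_radical (Ideal.subset_span ⟨i, rfl⟩)
  set y : σ → MvPolynomial σ R := fun i => C (x i) * X o - X i * C (x o) with hy
  set s : Finset (MvPolynomial σ R) := (Finset.univ.erase o).image y with hs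
  have hXo : (X o : MvPolynomial σ R) ∉ P.asIdeal := by
    rw [PrimeSpectrum.mem_mvPolynomialExtension]
    intro h
    have := h (Finsupp.single o 1)
    rw [coeff_X] at this
    rw [if_pos rfl] at this
    exact M.2.ne_top ((Ideal.eq_top_iff_one _).2 this)
  have hCP : ∀ r ∈ IsLocalRing.maximalIdeal R, (C r : MvPolynomial σ R) ∈ P.asIdeal := by
    intro r hr
    rw [PrimeSpectrum.mem_mvPolynomialExtension]
    intro s
    rw [coeff_C]
    split_ifs
    exacts [hr, zero_mem _]
  -- If F is not in P, then P is minimal over fewer than `Nat.card σ` elements, against Krull's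
  -- height theorem. Indeed, modulo a prime Q ≤ P containing the `y i`, homogeneity gives x_o^N F(X)
  -- = X_o^N F(x) = 0. So x_o is in Q, then every x_i, and hence P ≤ Q.
  have hmin : P.asIdeal ∈ (Ideal.span (s : Set (MvPolynomial σ R))).minimalPrimes := by
    refine ⟨⟨P.2, ?_⟩, ?_⟩
    · rw [Ideal.span_le]
      intro z hz
      simp only [hs, Finset.coe_image, Set.mem_image] at hz
      obtain ⟨i, -, rfl⟩ := hz
      exact sub_mem (Ideal.mul_mem_right _ _ (hCP _ (hxm i))) (Ideal.mul_mem_left _ _ (hCP _ (hxm o)))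
    · rintro Q ⟨hQ, hsQ⟩ hQP
      have hyQ : ∀ i, y i ∈ Q := by
        intro i
        by_cases hi : i = o
        · subst hi
          simp only [hy]
          rw [mul_comm, sub_self]
          exact zero_mem _
        · exact hsQ (Ideal.subset_span (by
            simp only [hs, Finset.coe_image]
            exact ⟨i, by simpa using hi, rfl⟩))
      have h1 : aeval (fun i => X o * C (x i)) F = (0 : MvPolynomial σ R) := by
        rw [hF.aeval_const_mul]
        have : aeval (fun i => (C (x i) : MvPolynomial σ R)) F = C (eval x F) := by
          simpa using (comp_aeval_apply (f := x) (Algebra.ofId R (MvPolynomial σ R)) F).symm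
        rw [this, h0]; simp
      have h2 : aeval (fun i => C (x o) * X i) F = C (x o) ^ N * F := by
        rw [hF.aeval_const_mul, aeval_X_left_apply]
      have h3 : C (x o) ^ N * F ∈ Q := by
        have hcong : (Ideal.Quotient.mkₐ R Q) (aeval (fun i => C (x o) * X i) F) =
            (Ideal.Quotient.mkₐ R Q) (aeval (fun i => X o * C (x i)) F) := by
          rw [comp_aeval_apply, comp_aeval_apply]
          congr 2
          funext i
          rw [Ideal.Quotient.mkₐ_eq_mk, eq_comm, Ideal.Quotient.mk_eq_mk_iff_sub_mem]
          simpa only [hy, mul_comm] using hyQ i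
        rw [h1, h2, map_zero, Ideal.Quotient.mkₐ_eq_mk] at hcong
        exact Ideal.Quotient.eq_zero_iff_mem.1 hcong
      have h4 : C (x o) ∈ Q := by
        rcases hQ.mem_or_mem h3 with h | h
        · exact hQ.mem_of_pow_mem _ h
        · exact absurd (hQP h) hFP
      have h5 : ∀ i, C (x i) ∈ Q := by
        intro i
        have : C (x i) * X o ∈ Q := by
          have := add_mem (hyQ i) (Ideal.mul_mem_left _ (X i) h4)
          simpa [hy] using this
        exact (hQ.mem_or_mem this).resolve_right fun h => hXo (hQP h)
      have h6 : IsLocalRing.maximalIdeal R ≤ Q.comap C := by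
        have := hQ.comap (C : R →+* MvPolynomial σ R)
        rw [← hx, this.radical_le_iff, Ideal.span_le]
        rintro _ ⟨i, rfl⟩
        exact h5 i
      intro G hG
      rw [PrimeSpectrum.mem_mvPolynomialExtension] at hG
      rw [G.as_sum]
      refine sum_mem fun d _ => ?_
      rw [← mul_one (coeff d G), ← C_mul_monomial]
      exact Ideal.mul_mem_right _ _ (h6 (hG d))
  have hle := Ideal.height_le_card_of_mem_minimalPrimes_span_finset hmin
  have hge : (IsLocalRing.maximalIdeal R).height ≤ P.asIdeal.height := by
    exact M.height_eq_orderHeight.trans_le ((Order.height_le_height_apply_of_strictMono _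
      (PrimeSpectrum.mvPolynomialExtension_strictMono σ) M).trans_eq P.height_eq_orderHeight.symm)
  have hcard : s.card < Nat.card σ := by
    rw [Nat.card_eq_fintype_card, hs]
    refine Finset.card_image_le.trans_lt ?_
    simpa using Finset.card_erase_lt_of_mem (Finset.mem_univ o)
  have hd : (IsLocalRing.maximalIdeal R).height = Nat.card σ := by
    have := IsLocalRing.maximalIdeal_height_eq_ringKrullDim (R := R)
    rw [hdim] at this
    exact_mod_cast this
  rw [hd] at hge
  have := hge.trans hle
  norm_cast at this
  omega

lemma IsLocalRing.exists_radical_span_range_eq {R σ : Type*} [CommRing R] [IsLocalRing R]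
    [IsNoetherianRing R] [Finite σ] (hdim : ringKrullDim R = Nat.card σ) :
    ∃ x : σ → R, (Ideal.span (Set.range x)).radical = IsLocalRing.maximalIdeal R := by
  obtain ⟨s, hs, hcard⟩ :=
    Ideal.exists_finset_card_eq_height_of_isNoetherianRing (IsLocalRing.maximalIdeal R)
  have hd := IsLocalRing.maximalIdeal_height_eq_ringKrullDim (R := R)
  rw [hdim, ← hcard] at hd
  have hd : s.card = Nat.card σ := by exact_mod_cast hd
  have e : σ ≃ s := (Finite.equivFinOfCardEq rfl).trans (Finite.equivFinOfCardEq (by simp [hd])).symm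
  refine ⟨fun i => e i, ?_⟩
  have : Set.range (fun i => (e i : R)) = s := by
    ext r
    exact ⟨fun ⟨i, hi⟩ => hi ▸ (e i).2, fun hr => ⟨e.symm ⟨r, hr⟩, by simp⟩⟩
  rw [this, Ideal.radical_eq_sInf]
  refine le_antisymm (sInf_le ⟨hs.1.2, hs.1.1⟩) (le_sInf ?_)
  rintro J ⟨h1, h2⟩
  exact hs.2 ⟨h2, h1⟩ (IsLocalRing.le_maximalIdeal h2.ne_top)

end AnalyticIndependence

/-! ### Reductions, minimal generators and rational points -/

section Reductions
open MvPolynomial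

/-- All forms over `R` vanishing on `a` vanish, after reduction to the residue field, at every
rational point. -/
def MvPolynomial.FormsVanishAtRationalPoints {R ι : Type*} [CommRing R] [IsLocalRing R]
    (a : ι → R) : Prop :=
  ∀ (N : ℕ) (H : MvPolynomial ι R), H.IsHomogeneous N → eval a H = 0 →
    ∀ l : ι → IsLocalRing.ResidueField R, eval l (H.map (IsLocalRing.residue R)) = 0

lemma MvPolynomial.isHomogeneous_sum_C_mul_X {R ι : Type*} [CommRing R]
    [Fintype ι] (c : ι → R) :
    (∑ i, C (c i) * X i : MvPolynomial ι R).IsHomogeneous 1 :=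
  IsHomogeneous.sum _ _ _ fun i _ => by simpa using (isHomogeneous_C ι (c i)).mul (isHomogeneous_X R i)

section
variable {R ι : Type*} [CommRing R] [IsLocalRing R] [Fintype ι] {a : ι → R}

/-- The residue vectors of the coefficients of linear combinations of `a` lying in `J`. -/
def IsLocalRing.residueRelations (a : ι → R) (J : Ideal R) :
    Submodule (IsLocalRing.ResidueField R) (ι → IsLocalRing.ResidueField R) where
  carrier := {v | ∃ c : ι → R, ∑ i, c i * a i ∈ J ∧ v = fun i => IsLocalRing.residue R (c i)}
  add_mem' := by
    rintro _ _ ⟨c, hc, rfl⟩ ⟨c', hc', rfl⟩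
    refine ⟨c + c', ?_, by ext; simp⟩
    simpa [add_mul, Finset.sum_add_distrib] using add_mem hc hc'
  zero_mem' := ⟨0, by simp, by ext; simp⟩
  smul_mem' := by
    rintro t _ ⟨c, hc, rfl⟩
    obtain ⟨t, rfl⟩ := IsLocalRing.residue_surjective t
    refine ⟨fun i => t * c i, ?_, by ext; simp⟩
    simpa [mul_assoc, Finset.mul_sum] using J.mul_mem_left t hc

lemma IsLocalRing.residueRelations_ne_top [IsNoetherianRing R] {J : Ideal R}
    (hJ : J ≤ Ideal.span (Set.range a)) (hne : J ≠ Ideal.span (Set.range a)) :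
    IsLocalRing.residueRelations a J ≠ ⊤ := by
  classical
  intro htop
  refine hne (le_antisymm hJ ?_)
  refine Submodule.le_of_le_smul_of_le_jacobson_bot (I := IsLocalRing.maximalIdeal R)
    (IsNoetherian.noetherian _) (IsLocalRing.maximalIdeal_le_jacobson _) ?_
  refine Ideal.span_le.2 ?_
  rintro _ ⟨i, rfl⟩
  have hi : Pi.single i 1 ∈ IsLocalRing.residueRelations a J := htop ▸ Submodule.mem_top
  obtain ⟨c, hc, hci⟩ := hi
  have : a i = ∑ j, c j * a j + ∑ j, ((Pi.single i 1 : ι → R) j - c j) * a j := by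
    rw [← Finset.sum_add_distrib]
    simp [sub_mul, Pi.single_apply]
  rw [SetLike.mem_coe, this]
  refine add_mem (Submodule.mem_sup_left hc) (Submodule.mem_sup_right (sum_mem fun j _ => ?_))
  refine Submodule.smul_mem_smul ?_ (Ideal.subset_span ⟨j, rfl⟩)
  rw [← IsLocalRing.residue_eq_zero_iff]
  have := congrFun hci j
  by_cases hj : j = i
  · subst hj
    simpa [sub_eq_zero] using this
  · simpa [Pi.single_apply, hj, eq_comm, -IsLocalRing.residue_eq_zero_iff] using this

/-- A functional killing the proper subspace `residueRelations a J` is a rational point l at which J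
I^r is represented by vanishing forms, whereas X_i^(r+1) represents an element of I^(r+1). -/
lemma MvPolynomial.FormsVanishAtRationalPoints.hasNoProperReduction [IsNoetherianRing R]
    (ha : FormsVanishAtRationalPoints a) : (Ideal.span (Set.range a)).HasNoProperReduction := by
  classical
  rintro J ⟨hJ, r, -, hr⟩
  by_contra hne
  obtain ⟨f, hf0, hf⟩ := Submodule.exists_le_ker_of_lt_top _
    (lt_top_iff_ne_top.2 (IsLocalRing.residueRelations_ne_top hJ hne))
  set l : ι → IsLocalRing.ResidueField R := fun i => f (Pi.single i 1) with hl
  have hfl : ∀ v, f v = ∑ i, v i * l i := fun v => by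
    rw [LinearMap.pi_apply_eq_sum_univ f v]
    refine Finset.sum_congr rfl fun i _ => ?_
    rw [smul_eq_mul, hl]
    congr 2
    ext j
    simp [Pi.single_apply, eq_comm]
  have key : ∀ z ∈ J * Ideal.span (Set.range a) ^ r, ∃ E : MvPolynomial ι R,
      E.IsHomogeneous (r + 1) ∧ eval a E = z ∧ eval l (E.map (IsLocalRing.residue R)) = 0 := by
    intro z hz
    refine Submodule.mul_induction_on hz ?_ ?_
    · intro b hb y hy
      obtain ⟨c, rfl⟩ := Ideal.mem_span_range_iff_exists_fun.1 (hJ hb)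
      obtain ⟨p, hp, rfl⟩ := (Ideal.mem_span_pow_iff_exists_isHomogeneous a y).1 hy
      refine ⟨p * ∑ i, C (c i) * X i, hp.mul (isHomogeneous_sum_C_mul_X c), ?_, ?_⟩
      · simp [mul_comm]
      · have : (fun i => IsLocalRing.residue R (c i)) ∈ IsLocalRing.residueRelations a J :=
          ⟨c, hb, rfl⟩
        have := LinearMap.mem_ker.1 (hf this)
        rw [hfl] at this
        simp [this]
    · rintro _ _ ⟨E, hE, rfl, h0⟩ ⟨E', hE', rfl, h0'⟩
      exact ⟨E + E', hE.add hE', by simp, by simp [h0, h0']⟩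
  have hl0 : ∀ i, l i = 0 := by
    intro i
    have : a i ^ (r + 1) ∈ J * Ideal.span (Set.range a) ^ r := by
      rw [← hr]
      exact Ideal.pow_mem_pow (Ideal.subset_span (Set.mem_range_self i)) _
    obtain ⟨E, hE, hEa, hEl⟩ := key _ this
    have := ha (r + 1) (X i ^ (r + 1) - E) ((isHomogeneous_X_pow i _).sub hE) (by simp [hEa]) l
    simpa [hEl] using this
  exact hf0 (LinearMap.ext fun v => by simp [hfl, hl0])

/-- With fewer generators b = A a and a = B b, the residue of A has a nonzero kernel vector l. The
linear relations X - B A X on a must vanish at l, forcing l = 0. -/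
lemma MvPolynomial.FormsVanishAtRationalPoints.isMinimallyGeneratedBy
    (ha : FormsVanishAtRationalPoints a) :
    (Ideal.span (Set.range a)).IsMinimallyGeneratedBy (Nat.card ι) := by
  refine ⟨⟨a ∘ (Finite.equivFin ι).symm, by rw [(Finite.equivFin ι).symm.surjective.range_comp]⟩, ?_⟩
  rintro m hm ⟨b, hb⟩
  have hA : ∀ j, ∃ c : ι → R, ∑ i, c i * a i = b j := fun j =>
    Ideal.mem_span_range_iff_exists_fun.1 (hb ▸ Ideal.subset_span ⟨j, rfl⟩)
  choose A hA using hA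
  have hB : ∀ i, ∃ c : Fin m → R, ∑ j, c j * b j = a i := fun i =>
    Ideal.mem_span_range_iff_exists_fun.1 (hb ▸ Ideal.subset_span ⟨i, rfl⟩)
  choose B hB using hB
  let f := Matrix.mulVecLin (Matrix.of fun j i => IsLocalRing.residue R (A j i))
  have hker : LinearMap.ker f ≠ ⊥ := LinearMap.ker_ne_bot_of_finrank_lt (by
    simpa [Nat.card_eq_fintype_card] using hm)
  obtain ⟨l, hl, hl0⟩ := Submodule.exists_mem_ne_zero_of_ne_bot hker
  apply hl0
  ext i
  have hl' : ∀ j, ∑ i, IsLocalRing.residue R (A j i) * l i = 0 := fun j => by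
    have := congrFun (LinearMap.mem_ker.1 hl) j
    simpa [f, Matrix.mulVec, dotProduct] using this
  have := ha 1 (X i - ∑ j, C (B i j) * ∑ i, C (A j i) * X i) ((isHomogeneous_X R i).sub
    (IsHomogeneous.sum _ _ _ fun j _ => by
      simpa using (isHomogeneous_C ι (B i j)).mul (isHomogeneous_sum_C_mul_X (A j))))
    (by simp [hA, hB]) l
  simpa [hl'] using this

end

/-- Forms in a system of parameters: vanishing at rational points can be tested over the residue
field. -/
lemma MvPolynomial.formsVanishAtRationalPoints_of_map {R σ ι : Type*} [CommRing R] [IsLocalRing R]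
    [IsNoetherianRing R] [Finite σ] (hdim : ringKrullDim R = Nat.card σ) {x : σ → R}
    (hx : (Ideal.span (Set.range x)).radical = IsLocalRing.maximalIdeal R)
    {D : ℕ} {G : ι → MvPolynomial σ R} (hG : ∀ i, (G i).IsHomogeneous D)
    (h : ∀ H : MvPolynomial ι (IsLocalRing.ResidueField R),
      aeval (fun i => (G i).map (IsLocalRing.residue R)) H = 0 → ∀ l, eval l H = 0) :
    FormsVanishAtRationalPoints fun i => eval x (G i) := by
  intro N H hH h0
  refine h _ ?_
  have h1 : eval x (aeval G H) = 0 := by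
    rw [← h0]
    simpa using comp_aeval_apply (f := G) (aeval x) H
  have h2 := map_residue_eq_zero_of_eval_eq_zero hdim hx (hH.aeval _ hG) h1
  exact (map_eval₂ _ G H).symm.trans h2

end Reductions

/-! ### Forms without common zeros and the radical -/

section Radical
open MvPolynomial

universe u

/-- Homogeneous polynomials whose reductions have no common zero outside the origin generate, when
evaluated at a system of parameters, an ideal with radical the maximal ideal. -/
lemma MvPolynomial.radical_span_range_eval_eq_maximalIdeal {R : Type u} {σ ι : Type*} [CommRing R]
    [IsLocalRing R] [Finite σ] {x : σ → R}
    (hx : (Ideal.span (Set.range x)).radical = IsLocalRing.maximalIdeal R)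
    {D : ℕ} (hD : 0 < D) {G : ι → MvPolynomial σ R} (hG : ∀ i, (G i).IsHomogeneous D)
    (h : ∀ (L : Type u) [Field L] [Algebra (IsLocalRing.ResidueField R) L] (z : σ → L),
      (∀ i, aeval z ((G i).map (IsLocalRing.residue R)) = 0) → z = 0) :
    (Ideal.span (Set.range fun i => eval x (G i))).radical = IsLocalRing.maximalIdeal R := by
  have hxm : ∀ i, x i ∈ IsLocalRing.maximalIdeal R := fun i =>
    hx ▸ Ideal.le_radical (Ideal.subset_span ⟨i, rfl⟩)
  refine le_antisymm ?_ ?_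
  · rw [(IsLocalRing.maximalIdeal.isMaximal R).isPrime.radical_le_iff, Ideal.span_le]
    rintro _ ⟨i, rfl⟩
    change eval x (G i) ∈ IsLocalRing.maximalIdeal R
    rw [← IsLocalRing.residue_eq_zero_iff, eval₂_comp]
    -- Writing the origin as 0 * 0 lets homogeneity pull out the factor 0^D.
    have : (IsLocalRing.residue R) ∘ x = fun j => 0 * (0 : IsLocalRing.ResidueField R) := by
      ext j
      simpa using hxm j
    rw [this, (hG i).eval₂_const_mul, zero_pow hD.ne', zero_mul]
  rw [Ideal.radical_eq_sInf (Ideal.span (Set.range fun i => eval x (G i)))]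
  refine le_sInf ?_
  rintro Q ⟨hIQ, hQ⟩
  rw [← hx, hQ.radical_le_iff, Ideal.span_le]
  by_contra hnot
  obtain ⟨_, ⟨j₀, rfl⟩, hj₀⟩ := Set.not_subset.1 hnot
  have : Nonempty σ := ⟨j₀⟩
  let f : R →+* FractionRing (R ⧸ Q) := (algebraMap (R ⧸ Q) _).comp (Ideal.Quotient.mk Q)
  have hf : ∀ r, f r = 0 ↔ r ∈ Q := fun r => by
    simp [f, Ideal.Quotient.eq_zero_iff_mem]
  -- If a prime Q contains the forms but not all x_i, take a valuation ring dominating the image of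
  -- R. Dividing by the x_j of largest value gives a common zero in V with j-th coordinate 1, which
  -- stays nonzero in the residue field.
  obtain ⟨V, hV, hloc⟩ := IsLocalRing.exists_factor_valuationRing f
  obtain ⟨j, hj⟩ := Finite.exists_max fun i => V.valuation (f (x i))
  have hxj : f (x j) ≠ 0 := by
    intro h0
    have := hj j₀
    rw [h0, map_zero, le_zero_iff, map_eq_zero, hf] at this
    exact hj₀ this
  have hu : ∀ i, f (x i) / f (x j) ∈ V := fun i => by
    rw [← V.valuation_le_one_iff, map_div₀]
    exact div_le_one_of_le₀ (hj i) zero_le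
  let u : σ → V := fun i => ⟨f (x i) / f (x j), hu i⟩
  let g : R →+* V := f.codRestrict V.toSubring hV
  have hGu : ∀ i, eval₂ g u (G i) = 0 := by
    intro i
    have h1 : f (eval x (G i)) = 0 := (hf _).2 (hIQ (Ideal.subset_span ⟨i, rfl⟩))
    rw [eval₂_comp] at h1
    have h2 : f ∘ x = fun l => f (x j) * (u l : FractionRing (R ⧸ Q)) := by
      ext l
      simp [u, mul_div_cancel₀ _ hxj]
    rw [h2, (hG i).eval₂_const_mul] at h1
    have h3 := (mul_eq_zero.1 h1).resolve_left (pow_ne_zero _ hxj)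
    have h4 := eval₂_comp_left V.subtype g u (G i)
    apply Subtype.val_injective
    exact h4.trans h3
  have hg : IsLocalHom g := hloc
  let res := IsLocalRing.ResidueField.map g
  let : Algebra (IsLocalRing.ResidueField R) (IsLocalRing.ResidueField V) := res.toAlgebra
  have hz := h (IsLocalRing.ResidueField V) (fun i => IsLocalRing.residue V (u i)) (fun i => by
    have := congrArg (IsLocalRing.residue V) (hGu i)
    rw [eval₂_comp_left, map_zero] at this
    rw [aeval_def, eval₂_map]
    exact this)
  have huj : u j = 1 := Subtype.ext (div_self hxj)
  have := congrFun hz j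
  simp [huj] at this

end Radical

/-! ### Interpolation at closed points of the affine line -/

section Interpolation
open Polynomial

lemma Ideal.exists_ne_zero_mem_of_finite {A : Type*} [CommRing A] [IsDomain A] {S : Set (Ideal A)}
    (hS : S.Finite) (h0 : ⊥ ∉ S) : ∃ f : A, f ≠ 0 ∧ ∀ M ∈ S, f ∈ M := by
  induction S, hS using Set.Finite.induction_on with
  | empty => exact ⟨1, one_ne_zero, by simp⟩
  | @insert M S _ _ ih =>
    obtain ⟨f, hf, hfS⟩ := ih fun h => h0 (Set.mem_insert_of_mem _ h)
    obtain ⟨m, hm, hm0⟩ := Submodule.exists_mem_ne_zero_of_ne_bot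
      (p := M) (by rintro rfl; exact h0 (Set.mem_insert _ _))
    refine ⟨m * f, mul_ne_zero hm0 hf, ?_⟩
    rintro N (rfl | hN)
    exacts [N.mul_mem_right _ hm, N.mul_mem_left _ (hfS N hN)]

lemma Polynomial.ne_bot_of_isMaximal {k : Type*} [Field k] {M : Ideal k[X]} (hM : M.IsMaximal) :
    M ≠ ⊥ :=
  Ring.ne_bot_of_isMaximal_of_not_isField hM (Polynomial.not_isField k)

/-- Euclid's argument: if f ≠ 0 lies in all the maximal ideals, then X f + 1 is a nonunit lying in
none. -/
lemma Polynomial.infinite_setOf_isMaximal (k : Type*) [Field k] :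
    {M : Ideal k[X] | M.IsMaximal}.Infinite := by
  intro hfin
  obtain ⟨f, hf, hfM⟩ := Ideal.exists_ne_zero_mem_of_finite hfin
    fun h => ne_bot_of_isMaximal h rfl
  have hu : ¬ IsUnit (X * f + 1) := by
    intro hu
    have h1 := natDegree_eq_zero_of_isUnit hu
    rw [natDegree_add_eq_left_of_natDegree_lt] at h1 <;> simp [natDegree_X_mul hf] at h1 ⊢
  obtain ⟨M, hM, hmem⟩ := exists_max_ideal_of_mem_nonunits hu
  have : (1 : k[X]) ∈ M := by
    simpa using M.sub_mem hmem (M.mul_mem_left X (hfM M hM))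
  exact hM.ne_top ((Ideal.eq_top_iff_one _).2 this)

lemma Polynomial.finite_setOf_isMaximal_mem {k : Type*} [Field k] {r : k[X]} (hr : r ≠ 0) :
    {M : Ideal k[X] | M.IsMaximal ∧ r ∈ M}.Finite := by
  refine (Ideal.finite_minimalPrimes_of_isNoetherianRing k[X] (Ideal.span {r})).subset ?_
  rintro M ⟨hM, hrM⟩
  refine ⟨⟨hM.isPrime, by simpa [Ideal.span_singleton_le_iff_mem] using hrM⟩, ?_⟩
  rintro P ⟨hP, hrP⟩ hPM
  have hP0 : P ≠ ⊥ := by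
    rintro rfl
    exact hr (by simpa [Ideal.span_singleton_le_iff_mem] using hrP)
  exact ((hP.isMaximal hP0).eq_of_le hM.ne_top hPM).ge

lemma Ideal.exists_forall_sub_mem_of_finite_isMaximal {A : Type*} [CommRing A] {S : Set (Ideal A)}
    (hS : S.Finite) (hmax : ∀ M ∈ S, M.IsMaximal) (ρ : Ideal A → A) :
    ∃ s : A, ∀ M ∈ S, s - ρ M ∈ M := by
  have := hS.to_subtype
  obtain ⟨s, hs⟩ := Ideal.exists_forall_sub_mem_ideal (I := fun M : S => M.1)
    (fun M N h => Ideal.isCoprime_iff_sup_eq.2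
      ((hmax M M.2).coprime_of_ne (hmax N N.2) fun h' => h (Subtype.ext h'))) (fun M => ρ M)
  exact ⟨s, fun M hM => hs ⟨M, hM⟩⟩

/-- Over a finite field there are polynomials without common zero (not even at infinity), of degree
at most a power of the characteristic, taking every nonzero vector of values. -/
lemma FiniteField.exists_polynomials_interpolating {k ι : Type*} [Field k] [Finite k] [Finite ι]
    {i₁ i₂ : ι} (hi : i₁ ≠ i₂) :
    ∃ D : ℕ, 0 < D ∧ (∀ c : k, c ^ D = c) ∧ ∃ g : ι → k[X], (∀ i, (g i).natDegree ≤ D) ∧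
      (g i₂).coeff D = 1 ∧ Ideal.span (Set.range g) = ⊤ ∧
      ∀ μ : ι → k, μ ≠ 0 → ∃ p : Ideal k[X], p ≠ ⊤ ∧ ∀ i, g i - C (μ i) ∈ p := by
  classical
  have := Fintype.ofFinite k
  have := Fintype.ofFinite ι
  have := (Polynomial.infinite_setOf_isMaximal k).to_subtype
  obtain ⟨e⟩ : Nonempty ((ι → k) ↪ {M : Ideal k[X] | M.IsMaximal}) :=
    ⟨(Fintype.equivFin _).toEmbedding.trans (Fin.valEmbedding.trans (Infinite.natEmbedding _))⟩
  let e' : (ι → k) ↪ Ideal k[X] := e.trans (Function.Embedding.subtype _)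
  have he' : ∀ μ, (e' μ).IsMaximal := fun μ => (e μ).2
  -- The prescribed value is μ_i at the point attached to μ ≠ 0. It is 1 at the point attached to 0
  -- and, by default, elsewhere, which rules out common zeros there.
  let ρ : ι → Ideal k[X] → k[X] := fun i => Function.extend e' (fun μ => if μ = 0 then 1 else C (μ i)) 1
  have hρ : ∀ i μ, ρ i (e' μ) = if μ = 0 then 1 else C (μ i) := fun i μ =>
    e'.injective.extend_apply _ _ _
  obtain ⟨r, hr⟩ := Ideal.exists_forall_sub_mem_of_finite_isMaximal (Set.finite_range e')
    (by rintro _ ⟨μ, rfl⟩; exact he' μ) (ρ i₁)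
  have hr0 : r ≠ 0 := by
    rintro rfl
    have := hr _ ⟨0, rfl⟩
    rw [hρ] at this
    exact (he' 0).ne_top ((Ideal.eq_top_iff_one _).2 (by simpa using this))
  -- Common zeros can only occur at zeros of r, the polynomial of index `i₁`. There are finitely
  -- many since r ≠ 0, so the others can be prescribed there too.
  let T : Set (Ideal k[X]) := Set.range e' ∪ {M | M.IsMaximal ∧ r ∈ M}
  have hT : T.Finite := (Set.finite_range e').union (finite_setOf_isMaximal_mem hr0)
  have hTmax : ∀ M ∈ T, M.IsMaximal := by
    rintro M (⟨μ, rfl⟩ | h)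
    exacts [he' μ, h.1]
  choose s hs using fun i => Ideal.exists_forall_sub_mem_of_finite_isMaximal hT hTmax (ρ i)
  obtain ⟨Q, hQ, hQT⟩ : ∃ Q : k[X], Q.Monic ∧ ∀ M ∈ T, Q ∈ M := by
    obtain ⟨f, hf, hfT⟩ := Ideal.exists_ne_zero_mem_of_finite hT
      fun h => ne_bot_of_isMaximal (hTmax _ h) rfl
    exact ⟨_, monic_mul_leadingCoeff_inv hf, fun M hM => M.mul_mem_right _ (hfT M hM)⟩
  let B := r.natDegree + Q.natDegree + ∑ i, (s i).natDegree
  -- A power of |k| makes c^D = c on k; the exponent B + 1 puts D above all degrees used so far.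
  let D := Fintype.card k ^ (B + 1)
  have hBD : B < D := (Nat.lt_succ_self B).trans (Nat.lt_pow_self Fintype.one_lt_card)
  have hsB : ∀ i, (s i).natDegree ≤ B := fun i =>
    (Finset.single_le_sum (f := fun i => (s i).natDegree) (fun _ _ => Nat.zero_le _)
      (Finset.mem_univ i)).trans (Nat.le_add_left _ _)
  have hQD : Q.natDegree ≤ D := by omega
  -- The added multiple of Q is monic of degree D and vanishes on T. It excludes a common zero at
  -- infinity without changing the prescribed values.
  let g : ι → k[X] := fun i =>
    if i = i₁ then r else if i = i₂ then s i + Q * X ^ (D - Q.natDegree) else s i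
  have hg₁ : g i₁ = r := if_pos rfl
  have hgT : ∀ i ≠ i₁, ∀ M ∈ T, g i - ρ i M ∈ M := by
    intro i hi M hM
    simp only [g, if_neg hi]
    split_ifs
    · rw [add_sub_right_comm]
      exact M.add_mem (hs i M hM) (M.mul_mem_right _ (hQT M hM))
    · exact hs i M hM
  have hge : ∀ μ i, g i - ρ i (e' μ) ∈ e' μ := by
    intro μ i
    by_cases hi : i = i₁
    · rw [hi, hg₁]
      exact hr _ ⟨μ, rfl⟩
    · exact hgT i hi _ (Or.inl ⟨μ, rfl⟩)
  have hQX : (Q * X ^ (D - Q.natDegree)).Monic := hQ.mul (monic_X_pow _)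
  have hQXdeg : (Q * X ^ (D - Q.natDegree)).natDegree = D := by
    rw [hQ.natDegree_mul (monic_X_pow _), natDegree_X_pow]
    omega
  refine ⟨D, by omega, fun c => FiniteField.pow_card_pow _ c, g, ?_, ?_, ?_, fun μ hμ =>
    ⟨e' μ, (he' μ).ne_top, fun i => by simpa [hρ, hμ] using hge μ i⟩⟩
  · intro i
    simp only [g]
    split_ifs
    · omega
    · exact natDegree_add_le_of_degree_le ((hsB i).trans hBD.le) hQXdeg.le
    · exact (hsB i).trans hBD.le
  · simp only [g, if_neg hi.symm, if_true]
    rw [coeff_add, coeff_eq_zero_of_natDegree_lt ((hsB i₂).trans_lt hBD), zero_add]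
    simpa [hQXdeg] using hQX.coeff_natDegree
  · by_contra hne
    obtain ⟨M, hM, hle⟩ := Ideal.exists_le_maximal _ hne
    have hgM : ∀ i, g i ∈ M := fun i => hle (Ideal.subset_span (Set.mem_range_self i))
    have hMT : M ∈ T := Or.inr ⟨hM, hg₁ ▸ hgM i₁⟩
    have hsub : ∀ i c, g i - c ∈ M → c ∈ M := fun i c h => by
      simpa using M.sub_mem (hgM i) h
    by_cases hMe : ∃ μ, e' μ = M
    · obtain ⟨μ, rfl⟩ := hMe
      by_cases hμ : μ = 0
      · have := hsub i₁ _ (hge μ i₁)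
        rw [hρ, if_pos hμ] at this
        exact hM.ne_top ((Ideal.eq_top_iff_one _).2 this)
      · obtain ⟨i, hi⟩ := Function.ne_iff.1 hμ
        have := hsub i _ (hge μ i)
        rw [hρ, if_neg hμ] at this
        exact hM.ne_top (Ideal.eq_top_of_isUnit_mem _ this (isUnit_C.2 (isUnit_iff_ne_zero.2 hi)))
    · have := hsub i₂ _ (hgT i₂ hi.symm M hMT)
      rw [show ρ i₂ M = 1 from Function.extend_apply' _ _ _ hMe] at this
      exact hM.ne_top ((Ideal.eq_top_iff_one _).2 this)

end Interpolation

/-! ### Construction of the forms and of the ideals -/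

section Construction
open MvPolynomial

/-- The binary form of degree `D` in the variables `X u` and `X v` with coefficients `c`. -/
noncomputable def MvPolynomial.binaryForm {R σ : Type*} [CommRing R] (D : ℕ) (u v : σ) (c : ℕ → R) :
    MvPolynomial σ R :=
  ∑ a ∈ Finset.range (D + 1), C (c a) * (X u ^ a * X v ^ (D - a))

section binaryForm
variable {R σ A : Type*} [CommRing R] [CommRing A] [Algebra R A] {D : ℕ} {u v : σ}

lemma MvPolynomial.isHomogeneous_binaryForm (D : ℕ) (u v : σ) (c : ℕ → R) :
    (binaryForm D u v c).IsHomogeneous D := by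
  refine IsHomogeneous.sum _ _ _ fun a ha => ?_
  have := (isHomogeneous_C σ (c a)).mul
    ((isHomogeneous_X_pow (R := R) u a).mul (isHomogeneous_X_pow v (D - a)))
  rwa [zero_add, Nat.add_sub_cancel' (Nat.lt_succ_iff.1 (Finset.mem_range.1 ha))] at this

lemma MvPolynomial.aeval_binaryForm (c : ℕ → R) (z : σ → A) :
    aeval z (binaryForm D u v c) =
      ∑ a ∈ Finset.range (D + 1), algebraMap R A (c a) * (z u ^ a * z v ^ (D - a)) := by
  simp [binaryForm]

lemma MvPolynomial.aeval_binaryForm_coeff {g : Polynomial R} (hg : g.natDegree ≤ D) {z : σ → A}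
    (hz : z v = 1) : aeval z (binaryForm D u v g.coeff) = Polynomial.aeval (z u) g := by
  rw [aeval_binaryForm, Polynomial.aeval_eq_sum_range' (Nat.lt_succ_of_le hg)]
  simp [hz, Algebra.smul_def]

lemma MvPolynomial.aeval_binaryForm_of_eq_zero (c : ℕ → R) {z : σ → A} (hz : z v = 0) :
    aeval z (binaryForm D u v c) = algebraMap R A (c D) * z u ^ D := by
  rw [aeval_binaryForm, Finset.sum_range_succ, Finset.sum_eq_zero]
  · simp
  · intro a ha
    rw [hz, zero_pow (Nat.sub_ne_zero_of_lt (Finset.mem_range.1 ha)), mul_zero, mul_zero]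

end binaryForm

/-- The point z need not be rational, only its image under G, because k embeds in A. This permits
closed points with larger residue field. -/
lemma MvPolynomial.eval_eq_zero_of_aeval_eq_zero {k σ ι A : Type*} [Field k] [CommRing A]
    [Nontrivial A] [Algebra k A] {G : ι → MvPolynomial σ k} {H : MvPolynomial ι k}
    (hH : aeval G H = 0) {l : ι → k} (z : σ → A)
    (hz : ∀ i, aeval z (G i) = algebraMap k A (l i)) : eval l H = 0 := by
  have h1 := comp_aeval_apply (f := G) (aeval z) H
  rw [hH, map_zero] at h1
  simp_rw [hz] at h1
  have h2 := comp_aeval_apply (f := l) (Algebra.ofId k A) H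
  apply FaithfulSMul.algebraMap_injective k A
  rw [map_zero, h1]
  simpa using h2

/-- Over a finite field `k`, in the polynomial ring in `2 + e` variables there are forms of the same
degree without nontrivial common zeros which parametrize all rational points of `k ^ (m + e)`. -/
lemma FiniteField.exists_forms_surjective_on_rationalPoints (k : Type*) [Field k] [Finite k]
    (e : ℕ) {m : ℕ} (hm : 2 ≤ m) :
    ∃ D : ℕ, 0 < D ∧ ∃ G : Fin m ⊕ Fin e → MvPolynomial (Fin 2 ⊕ Fin e) k,
      (∀ i, (G i).IsHomogeneous D) ∧
      (∀ H : MvPolynomial (Fin m ⊕ Fin e) k, aeval G H = 0 → ∀ l, eval l H = 0) ∧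
      ∀ (L : Type*) [Field L] [Algebra k L] (z : Fin 2 ⊕ Fin e → L),
        (∀ i, aeval z (G i) = 0) → z = 0 := by
  obtain ⟨D, hD, hpow, g, hdeg, hlead, hspan, hint⟩ :=
    FiniteField.exists_polynomials_interpolating (k := k) (ι := Fin m)
      (i₁ := ⟨0, by omega⟩) (i₂ := ⟨1, by omega⟩) (by simp)
  let G : Fin m ⊕ Fin e → MvPolynomial (Fin 2 ⊕ Fin e) k :=
    Sum.elim (fun i => binaryForm D (Sum.inl 0) (Sum.inl 1) (g i).coeff) fun j => X (Sum.inr j) ^ D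
  have hGl : ∀ i, G (Sum.inl i) = binaryForm D (Sum.inl 0) (Sum.inl 1) (g i).coeff := fun _ => rfl
  have hGr : ∀ j, G (Sum.inr j) = X (Sum.inr j) ^ D := fun _ => rfl
  have hG : ∀ i, (G i).IsHomogeneous D := by
    rintro (i | j)
    exacts [isHomogeneous_binaryForm _ _ _ _, isHomogeneous_X_pow _ _]
  refine ⟨D, hD, G, hG, ?_, ?_⟩
  · intro H hH l
    -- The zero vector comes from the origin of the two binary variables, any other from its closed
    -- point p. The remaining coordinates are their own D-th powers.
    by_cases hl : l ∘ Sum.inl = 0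
    · refine eval_eq_zero_of_aeval_eq_zero (A := k) hH (Sum.elim 0 (l ∘ Sum.inr)) ?_
      rintro (i | j)
      · have : l (Sum.inl i) = 0 := congrFun hl i
        rw [this, hGl, aeval_binaryForm_of_eq_zero _ (by simp)]
        simp [hD.ne']
      · simp [hGr, hpow]
    · obtain ⟨p, hp, hgp⟩ := hint _ hl
      have : Nontrivial (Polynomial k ⧸ p) := Ideal.Quotient.nontrivial_iff.2 hp
      refine eval_eq_zero_of_aeval_eq_zero (A := Polynomial k ⧸ p) hH
        (Sum.elim ![Ideal.Quotient.mk p Polynomial.X, 1] fun j => algebraMap _ _ (l (Sum.inr j))) ?_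
      rintro (i | j)
      · rw [hGl, aeval_binaryForm_coeff (hdeg i) (by simp)]
        have h1 := Ideal.Quotient.mk_eq_mk_iff_sub_mem _ _ |>.2 (hgp i)
        have h2 := Polynomial.aeval_algHom_apply (Ideal.Quotient.mkₐ k p) Polynomial.X (g i)
        rw [Polynomial.aeval_X_left_apply] at h2
        exact h2.trans h1
      · rw [hGr, map_pow, aeval_X, Sum.elim_inr, ← map_pow, hpow]
  · intro L _ _ z hz
    have hz1 : z (Sum.inl 1) = 0 := by
      by_contra h1
      have hgz : ∀ i, Polynomial.aeval (z (Sum.inl 0) / z (Sum.inl 1)) (g i) = 0 := by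
        intro i
        have h2 := hz (Sum.inl i)
        have h3 : z = fun j => z (Sum.inl 1) * (z j / z (Sum.inl 1)) := by
          ext j
          rw [mul_div_cancel₀ _ h1]
        have h4 := (hG (Sum.inl i)).aeval_const_mul (z (Sum.inl 1)) fun j => z j / z (Sum.inl 1)
        rw [← h3, h2, eq_comm, hGl, aeval_binaryForm_coeff (hdeg i) (by exact div_self h1)] at h4
        exact (mul_eq_zero.1 h4).resolve_left (pow_ne_zero _ h1)
      have hle : Ideal.span (Set.range g) ≤
          RingHom.ker (Polynomial.aeval (R := k) (z (Sum.inl 0) / z (Sum.inl 1))) := by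
        rw [Ideal.span_le]
        rintro _ ⟨i, rfl⟩
        exact hgz i
      rw [hspan] at hle
      have h5 := hle (Submodule.mem_top (x := (1 : Polynomial k)))
      rw [RingHom.mem_ker, map_one] at h5
      exact one_ne_zero h5
    have hz0 : z (Sum.inl 0) = 0 := by
      have h2 := hz (Sum.inl ⟨1, by omega⟩)
      rw [hGl, aeval_binaryForm_of_eq_zero _ hz1, hlead, map_one, one_mul] at h2
      exact eq_zero_of_pow_eq_zero h2
    ext (j | j)
    · fin_cases j
      exacts [hz0, hz1]
    · have := hz (Sum.inr j)
      simpa [hGr, hD.ne'] using this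

lemma MvPolynomial.IsHomogeneous.exists_lift {R S σ : Type*} [CommRing R] [CommRing S]
    {f : R →+* S} (hf : Function.Surjective f) {G : MvPolynomial σ S} {D : ℕ}
    (hG : G.IsHomogeneous D) : ∃ F : MvPolynomial σ R, F.IsHomogeneous D ∧ F.map f = G := by
  refine ⟨∑ d ∈ G.support, monomial d (Function.surjInv hf (G.coeff d)),
    IsHomogeneous.sum _ _ _ fun d hd => isHomogeneous_monomial _ ?_, ?_⟩
  · rw [Finsupp.degree_eq_weight_one]
    exact hG (mem_support_iff.1 hd)
  · conv_rhs => rw [G.as_sum]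
    simp [map_monomial, Function.surjInv_eq]

lemma IsLocalRing.exists_isPrimary_hasNoProperReduction {R : Type*} [CommRing R] [IsLocalRing R]
    [IsNoetherianRing R] [Finite (IsLocalRing.ResidueField R)] {d : ℕ} (hd : 2 ≤ d)
    (hdim : ringKrullDim R = d) {n : ℕ} (hn : d ≤ n) :
    ∃ I : Ideal R, I.IsPrimary ∧ I.radical = IsLocalRing.maximalIdeal R ∧
      I.IsMinimallyGeneratedBy n ∧ I.HasNoProperReduction := by
  -- With d = 2 + e and n = m + e, two parameters feed m binary forms and the other e enter through
  -- their D-th powers.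
  obtain ⟨e, rfl⟩ := Nat.exists_eq_add_of_le hd
  obtain ⟨m, rfl⟩ := Nat.exists_eq_add_of_le' (show e ≤ n by omega)
  have hdim' : ringKrullDim R = Nat.card (Fin 2 ⊕ Fin e) := by simpa using hdim
  obtain ⟨x, hx⟩ := IsLocalRing.exists_radical_span_range_eq hdim'
  obtain ⟨D, hD, Gk, hGk, hpts, hzero⟩ :=
    FiniteField.exists_forms_surjective_on_rationalPoints (IsLocalRing.ResidueField R) e
      (show 2 ≤ m by omega)
  choose G hG hGmap using fun i => (hGk i).exists_lift IsLocalRing.residue_surjective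
  have ha : FormsVanishAtRationalPoints fun i => eval x (G i) :=
    formsVanishAtRationalPoints_of_map hdim' hx hG (by simpa only [hGmap] using hpts)
  have hrad := radical_span_range_eval_eq_maximalIdeal hx hD hG
    (by simpa only [hGmap] using hzero)
  refine ⟨_, Ideal.isPrimary_of_isMaximal_radical ?_, hrad, ?_, ha.hasNoProperReduction⟩
  · rw [hrad]
    exact IsLocalRing.maximalIdeal.isMaximal R
  · simpa using ha.isMinimallyGeneratedBy

lemma IsLocalRing.exists_hasNoProperReduction_of_le {R : Type*} [CommRing R] [IsLocalRing R]
    [IsNoetherianRing R] {d : ℕ} (hdim : ringKrullDim R = d) {n : ℕ} (hn : n ≤ d) :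
    ∃ I : Ideal R, I.IsMinimallyGeneratedBy n ∧ I.HasNoProperReduction := by
  have hdim' : ringKrullDim R = Nat.card (Fin d) := by simpa using hdim
  obtain ⟨x, hx⟩ := IsLocalRing.exists_radical_span_range_eq hdim'
  have ha : FormsVanishAtRationalPoints fun i : Fin n => eval x (X (Fin.castLE hn i)) := by
    refine formsVanishAtRationalPoints_of_map hdim' hx (fun i => isHomogeneous_X _ _) ?_
    intro H hH l
    -- The forms are n of the d variables, so a rational point is attained by padding it with zeros.
    refine eval_eq_zero_of_aeval_eq_zero (A := IsLocalRing.ResidueField R) hH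
      (Function.extend (Fin.castLE hn) l 0) fun i => ?_
    simp [(Fin.castLE_injective hn).extend_apply]
  exact ⟨_, by simpa using ha.isMinimallyGeneratedBy, ha.hasNoProperReduction⟩

end Construction

theorem theorem3p9 {R : Type*} [CommRing R] [IsLocalRing R] [IsNoetherianRing R]
    [Finite (IsLocalRing.ResidueField R)] (d : ℕ) (hd : 2 ≤ d) (hdim : ringKrullDim R = d)
    (n : ℕ) (hn : 0 < n) :
    (∃ I : Ideal R, I.IsMinimallyGeneratedBy n ∧ I.HasNoProperReduction) ∧
    (d ≤ n → ∃ I : Ideal R, I.IsPrimary ∧ I.radical = IsLocalRing.maximalIdeal R ∧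
      I.IsMinimallyGeneratedBy n ∧ I.HasNoProperReduction) := by
  refine ⟨?_, IsLocalRing.exists_isPrimary_hasNoProperReduction hd hdim⟩
  rcases le_total n d with h | h
  · exact IsLocalRing.exists_hasNoProperReduction_of_le hdim h
  · obtain ⟨I, -, -, hI⟩ := IsLocalRing.exists_isPrimary_hasNoProperReduction hd hdim h
    exact ⟨I, hI⟩
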